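/- Terms are built from variables $x_0,x_1,\dots$ and integer constants by addition and by multiplication with integers. Formulas of $\mathrm{FO}[\exists^{(q,p)}x]$ are built from atomic formulas $s<t$ and $s\equiv_k t$ ($s,t$ terms, $k\ge 1$ a natural number) by means of $\neg,\wedge,\vee,\to,\leftrightarrow$, the quantifier $\exists x$, and the quantifiers $\exists^{(q,p)}x$ ($q,p\in\mathbb N$, $p\ge 2$). They are interpreted in $\mathbb Z$: $s\equiv_k t$ means that $k$ divides $s-t$, and $\exists^{(q,p)}x\,\psi$ means that the set of witnesses $x\in\mathbb Z$ for $\psi$ is finite and its cardinality is congruent to $q$ modulo $p$. The quantifier-depth of a formula is the maximal nesting depth of quantifiers (of both kinds). For a formula $\varphi$, let - $\mathrm{Coeff}(\varphi)$ be the set consisting of $0,\pm1,\pm2$ and all $\pm a$ where $a$ is the coefficient of some variable in the normal form $a_1x_{i_1}+\dots+a_nx_{i_n}+c$ of $s-t$ for some atomic formula $s<t$ occurring in $\varphi$; - $\mathrm{Const}(\varphi)$ be the set consisting of $0,\pm1,\pm2$ and all $\pm c$ where $c$ is the constant in the normal form of $s-t$ for some atomic formula $s<t$ occurring in $\varphi$;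 - $\mathrm{Mod}(\varphi)$ be the set consisting of $1$ and all $k$ such that an atomic formula $s\equiv_k t$ or a quantifier $\exists^{(q,k)}$ occurs in $\varphi$; - $\mathrm P(\varphi)=\mathrm{Coeff}(\varphi)\cup\mathrm{Mod}(\varphi)$. **Corollary C1.** There exists an integer $\kappa\ge 2$ with the following property. Let $d\ge 1$ and $\ell\ge 0$ be integers, let $\varphi(x,y_1,\dots,y_\ell)$ be a formula of $\mathrm{FO}[\exists^{(q,p)}x]$ of quantifier-depth at most $d$ whose free variables are among the distinct variables $x,y_1,\dots,y_\ell$, let $N\ge 1$ be an integer, and let $n_1,\dots,n_\ell\in\mathbb Z$ with $|n_i|\le N$ for all $i$. Then $\exists x\colon\varphi(x,n_1,\dots,n_\ell)$ holds in $\mathbb Z$ if and only if there exists $n\in\mathbb Z$ such that $\varphi(n,n_1,\dots,n_\ell)$ holds and $$|n|\le 2^{(\max \mathrm P(\varphi))^{\kappa^d}}\cdot\max\mathrm{Const}(\varphi)\cdot N\cdot\max\{1,\ell\}.$$ -/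

import Mathlib

namespace PresburgerMod

/-- Assignments of integers to the variables `x_0, x_1, x_2, …`. -/
abbrev Assignment : Type := ℕ → ℤ

/-- Terms: variables `x_i`, integer constants `c`, multiples `a s` (with `a` an integer),
and sums `s + t`. -/
inductive Term : Type
  | var (i : ℕ) : Term
  | const (c : ℤ) : Term
  | smul (a : ℤ) (s : Term) : Term
  | add (s t : Term) : Term

namespace Term

/-- The value of a term under an assignment. -/
def eval (f : Assignment) : Term → ℤ
  | var i => f i
  | const c => c
  | smul a s => a * s.eval f
  | add s t => s.eval f + t.eval f

/-- `s - t` abbreviates `s + (-1) t`. -/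
def sub (s t : Term) : Term := add s (smul (-1) t)

/-- The variables occurring in a term. -/
def vars : Term → Finset ℕ
  | var i => {i}
  | const _ => ∅
  | smul _ s => s.vars
  | add s t => s.vars ∪ t.vars

/-- The coefficient of `x_i` in the normal form `a_1 x_{i_1} + ⋯ + a_n x_{i_n} + c` of a term
(zero if `x_i` does not occur in the normal form). -/
def coeff (i : ℕ) : Term → ℤ
  | var j => if i = j then 1 else 0
  | const _ => 0
  | smul a s => a * s.coeff i
  | add s t => s.coeff i + t.coeff i

/-- The constant `c` in the normal form of a term. -/
def constTerm : Term → ℤ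
  | var _ => 0
  | const c => c
  | smul a s => a * s.constTerm
  | add s t => s.constTerm + t.constTerm

/-- The coefficients of the normal form of a term. Variables that cancel may contribute the
number `0`, which belongs to every set of coefficients considered below anyway. -/
def coeffs (t : Term) : Finset ℤ := t.vars.image fun i => t.coeff i

end Term

/-- Formulas of the logic `FO[∃^{(q,p)} x]`: atomic formulas `s < t` and `s ≡_k t` with `k ≥ 1`,
Boolean combinations, the quantifier `∃ x`, and the unary modulo-counting quantifiers
`∃^{(q,p)} x` with `q` a natural number and `p ≥ 2`. -/
inductive Formula : Type
  | lt (s t : Term) : Formula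
  | modEq (k : ℕ) (hk : 1 ≤ k) (s t : Term) : Formula
  | neg (φ : Formula) : Formula
  | and (φ ψ : Formula) : Formula
  | or (φ ψ : Formula) : Formula
  | imp (φ ψ : Formula) : Formula
  | iff (φ ψ : Formula) : Formula
  | ex (x : ℕ) (φ : Formula) : Formula
  | exMod (q p : ℕ) (hp : 2 ≤ p) (x : ℕ) (φ : Formula) : Formula

namespace Formula

/-- Truth of a formula under an assignment. The formula `∃^{(q,p)} x φ` says that the set of
witnesses is finite and that its number of elements is congruent to `q` modulo `p`. -/
def Holds : Formula → Assignment → Prop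
  | lt s t, f => s.eval f < t.eval f
  | modEq k _ s t, f => (k : ℤ) ∣ s.eval f - t.eval f
  | neg φ, f => ¬ φ.Holds f
  | and φ ψ, f => φ.Holds f ∧ ψ.Holds f
  | or φ ψ, f => φ.Holds f ∨ ψ.Holds f
  | imp φ ψ, f => φ.Holds f → ψ.Holds f
  | iff φ ψ, f => (φ.Holds f ↔ ψ.Holds f)
  | ex x φ, f => ∃ a : ℤ, φ.Holds (Function.update f x a)
  | exMod q p _ x φ, f =>
      {a : ℤ | φ.Holds (Function.update f x a)}.Finite ∧
        {a : ℤ | φ.Holds (Function.update f x a)}.ncard ≡ q [MOD p]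

/-- The free variables of a formula. -/
def freeVars : Formula → Finset ℕ
  | lt s t => s.vars ∪ t.vars
  | modEq _ _ s t => s.vars ∪ t.vars
  | neg φ => φ.freeVars
  | and φ ψ => φ.freeVars ∪ ψ.freeVars
  | or φ ψ => φ.freeVars ∪ ψ.freeVars
  | imp φ ψ => φ.freeVars ∪ ψ.freeVars
  | iff φ ψ => φ.freeVars ∪ ψ.freeVars
  | ex x φ => φ.freeVars.erase x
  | exMod _ _ _ x φ => φ.freeVars.erase x

/-- Quantifier depth. -/
def qd : Formula → ℕ
  | lt _ _ => 0
  | modEq _ _ _ _ => 0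
  | neg φ => φ.qd
  | and φ ψ => max φ.qd ψ.qd
  | or φ ψ => max φ.qd ψ.qd
  | imp φ ψ => max φ.qd ψ.qd
  | iff φ ψ => max φ.qd ψ.qd
  | ex _ φ => 1 + φ.qd
  | exMod _ _ _ _ φ => 1 + φ.qd

/-- `Coeff(φ)`: the numbers `0, ±1, ±2` and `±a` for `a` a coefficient of `s - t`, where `s < t`
is an atomic formula occurring in `φ` (congruences do not contribute). -/
def coeffSet : Formula → Finset ℤ
  | lt s t => {0, 1, -1, 2, -2} ∪ (s.sub t).coeffs ∪ (s.sub t).coeffs.image (fun a => -a)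
  | modEq _ _ _ _ => {0, 1, -1, 2, -2}
  | neg φ => φ.coeffSet
  | and φ ψ => φ.coeffSet ∪ ψ.coeffSet
  | or φ ψ => φ.coeffSet ∪ ψ.coeffSet
  | imp φ ψ => φ.coeffSet ∪ ψ.coeffSet
  | iff φ ψ => φ.coeffSet ∪ ψ.coeffSet
  | ex _ φ => φ.coeffSet
  | exMod _ _ _ _ φ => φ.coeffSet

/-- `Const(φ)`: the numbers `0, ±1, ±2` and `±c` for `c` the constant of `s - t`, where `s < t`
is an atomic formula occurring in `φ` (congruences do not contribute). -/
def constSet : Formula → Finset ℤ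
  | lt s t => {0, 1, -1, 2, -2, (s.sub t).constTerm, -(s.sub t).constTerm}
  | modEq _ _ _ _ => {0, 1, -1, 2, -2}
  | neg φ => φ.constSet
  | and φ ψ => φ.constSet ∪ ψ.constSet
  | or φ ψ => φ.constSet ∪ ψ.constSet
  | imp φ ψ => φ.constSet ∪ ψ.constSet
  | iff φ ψ => φ.constSet ∪ ψ.constSet
  | ex _ φ => φ.constSet
  | exMod _ _ _ _ φ => φ.constSet

/-- `Mod(φ)`: the number `1` and all `k` such that `≡_k` or a quantifier `∃^{(q,k)}` occurs
in `φ`. -/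
def modSet : Formula → Finset ℕ
  | lt _ _ => {1}
  | modEq k _ _ _ => {1, k}
  | neg φ => φ.modSet
  | and φ ψ => φ.modSet ∪ ψ.modSet
  | or φ ψ => φ.modSet ∪ ψ.modSet
  | imp φ ψ => φ.modSet ∪ ψ.modSet
  | iff φ ψ => φ.modSet ∪ ψ.modSet
  | ex _ φ => φ.modSet
  | exMod _ p _ _ φ => insert p φ.modSet

/-- `P(φ) = Coeff(φ) ∪ Mod(φ)`. -/
def parSet (φ : Formula) : Finset ℤ := φ.coeffSet ∪ φ.modSet.image (fun k : ℕ => (k : ℤ))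

theorem two_mem_coeffSet (φ : Formula) : (2 : ℤ) ∈ φ.coeffSet := by
  induction φ <;> simp_all [coeffSet]

theorem two_mem_constSet (φ : Formula) : (2 : ℤ) ∈ φ.constSet := by
  induction φ <;> simp_all [constSet]

theorem two_mem_parSet (φ : Formula) : (2 : ℤ) ∈ φ.parSet :=
  Finset.mem_union_left _ φ.two_mem_coeffSet

/-- `max P(φ)`, as a natural number; the maximum is at least `2`, see `coe_maxPar`. -/
def maxPar (φ : Formula) : ℕ := (φ.parSet.max' ⟨2, φ.two_mem_parSet⟩).toNat

/-- `max Const(φ)`, as a natural number; the maximum is at least `2`, see `coe_maxConst`. -/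
def maxConst (φ : Formula) : ℕ := (φ.constSet.max' ⟨2, φ.two_mem_constSet⟩).toNat

theorem coe_maxPar (φ : Formula) :
    (φ.maxPar : ℤ) = φ.parSet.max' ⟨2, φ.two_mem_parSet⟩ := by
  have h := φ.parSet.le_max' 2 φ.two_mem_parSet
  exact Int.toNat_of_nonneg (by omega)

theorem coe_maxConst (φ : Formula) :
    (φ.maxConst : ℤ) = φ.constSet.max' ⟨2, φ.two_mem_constSet⟩ := by
  have h := φ.constSet.le_max' 2 φ.two_mem_constSet
  exact Int.toNat_of_nonneg (by omega)

end Formula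

end PresburgerMod

namespace PresburgerMod

open Function

/-! ### Sets of integers that are periodic away from a finite set of critical points -/

/-! Let P and C be the maxima of P(φ) and Const(φ). Call two assignments indistinguishable at level
i (`Indist`) if they agree modulo M_i and every linear form with coefficients at most A_i and
constant at most C_i has the same sign at both. Formulas of depth at most i cannot separate such
assignments (`holds_iff_of_indist`). For the quantifier step, let W be the witness set at f. Passing
from a to a - M_i can change membership only if a small form changes sign in between, and then a is
`Critical`: it solves α a = t with α and t small. So W is M_i-periodic off finitely many critical
points. Solving the same equations at a g indistinguishable from f at level i + 1 matches the
critical points in order, modulo M_i p and in membership (`Indist.matching`). This transfers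
nonemptiness, infinitude and, by summation by parts, the cardinality modulo p. The witness bound
uses periodicity once more: a nonempty W contains a critical point or one shifted by M_d
(`exists_critical`), and critical points are bounded linearly in the parameters. No quantifier is
eliminated; only the numerical bounds grow, with A_i = P^(3^i), while M_i and C_i / C are at most
2^(A_i^2). -/

theorem mem_add_nsmul_iff {W : Set ℤ} {M a : ℤ}
    (h : ∀ n : ℕ, a + (n + 1) * M ∈ W ↔ a + (n + 1) * M - M ∈ W) (n : ℕ) :
    a + n * M ∈ W ↔ a ∈ W := by
  induction n with
  | zero => simp
  | succ n ih =>
    rw [← ih, Nat.cast_succ, h n]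
    ring_nf

theorem mem_sub_nsmul_iff {W : Set ℤ} {M a : ℤ}
    (h : ∀ n : ℕ, a - n * M ∈ W ↔ a - n * M - M ∈ W) (n : ℕ) :
    a - n * M ∈ W ↔ a ∈ W := by
  induction n with
  | zero => simp
  | succ n ih =>
    rw [← ih, h n, Nat.cast_succ]
    ring_nf

theorem mem_emod_iff {W : Set ℤ} {M : ℤ} (h : ∀ a, a ∈ W ↔ a - M ∈ W) (a : ℤ) :
    a % M ∈ W ↔ a ∈ W := by
  have key : ∀ (b : ℤ) (n : ℤ), b + n * M ∈ W ↔ b ∈ W := by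
    intro b n
    obtain ⟨m, rfl | rfl⟩ := n.eq_nat_or_neg
    · exact mem_add_nsmul_iff (fun n => h _) m
    · have := mem_sub_nsmul_iff (W := W) (M := M) (a := b) (fun n => h _) m
      rwa [sub_eq_add_neg, ← neg_mul] at this
  have := key (a % M) (a / M)
  rw [mul_comm, Int.emod_add_mul_ediv] at this
  exact this.symm

/-- A nonempty set that is `M`-periodic away from `D`, where `D` meets every residue class,
has a member at distance `0` or `M` from `D`. -/
theorem exists_critical {W D : Set ℤ} {M : ℤ} (hM : 0 < M)
    (h : ∀ a ∉ D, (a ∈ W ↔ a - M ∈ W)) (hD : ∀ r, 0 ≤ r → r < M → r ∈ D) (hW : W.Nonempty) :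
    ∃ a ∈ D, a ∈ W ∨ a - M ∈ W := by
  by_contra! hcon
  obtain ⟨a, ha⟩ := hW
  -- If W avoids all critical points and their shifts, the equivalence also holds on `D`, so W is
  -- fully periodic and its representative in [0, M) is a critical member.
  have hper : ∀ a, a ∈ W ↔ a - M ∈ W := by
    intro a
    by_cases haD : a ∈ D
    · exact iff_of_false (hcon a haD).1 (hcon a haD).2
    · exact h a haD
  have hr := hD (a % M) (Int.emod_nonneg _ hM.ne') (Int.emod_lt_of_pos _ hM)
  exact (hcon _ hr).1 ((mem_emod_iff hper a).2 ha)

/-- `R` matches the critical points of `W` with those of `W'`. -/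
structure Matching (M p : ℤ) (W W' : Set ℤ) (R : ℤ → ℤ → Prop) : Prop where
  lt_iff : ∀ {a b a' b'}, R a b → R a' b' → (a < a' ↔ b < b')
  dvd : ∀ {a b}, R a b → M * p ∣ b - a
  mem_iff : ∀ {a b}, R a b → (a ∈ W ↔ b ∈ W')
  sub_mem_iff : ∀ {a b}, R a b → (a - M ∈ W ↔ b - M ∈ W')
  left : ∀ a, (∀ b, ¬ R a b) → (a ∈ W ↔ a - M ∈ W)
  right : ∀ b, (∀ a, ¬ R a b) → (b ∈ W' ↔ b - M ∈ W')
  base : ∀ r, 0 ≤ r → r < M → R r r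
  bounded : ∃ B : ℤ, ∀ a b, R a b → |a| ≤ B ∧ |b| ≤ B

/-! ### Transfer of nonemptiness and infinitude along a matching -/

namespace Matching

variable {M p : ℤ} {W W' : Set ℤ} {R : ℤ → ℤ → Prop}

theorem symm (h : Matching M p W W' R) : Matching M p W' W (fun a b => R b a) where
  lt_iff h₁ h₂ := (h.lt_iff h₁ h₂).symm
  dvd h₁ := by
    rw [dvd_sub_comm]
    exact h.dvd h₁
  mem_iff h₁ := (h.mem_iff h₁).symm
  sub_mem_iff h₁ := (h.sub_mem_iff h₁).symm
  left := h.right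
  right := h.left
  base := h.base
  bounded := h.bounded.imp fun _ hB a b hab => (hB b a hab).symm

/-- Order preservation in both directions makes `R` the graph of a bijection between critical
points. -/
theorem eq_iff (h : Matching M p W W' R) {a b a' b' : ℤ} (h₁ : R a b) (h₂ : R a' b') :
    a = a' ↔ b = b' := by
  have := h.lt_iff h₁ h₂
  have := h.lt_iff h₂ h₁
  omega

theorem nonempty (h : Matching M p W W' R) (hM : 0 < M) (hW : W.Nonempty) : W'.Nonempty := by
  obtain ⟨a, ⟨b, hab⟩, ha | ha⟩ := exists_critical (D := {a | ∃ b, R a b}) hM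
    (fun a ha => h.left a (not_exists.1 ha)) (fun r h₀ h₁ => ⟨r, h.base r h₀ h₁⟩) hW
  · exact ⟨b, (h.mem_iff hab).1 ha⟩
  · exact ⟨b - M, (h.sub_mem_iff hab).1 ha⟩

/-- An infinite W has a member a beyond all critical points. From the outermost critical point in
the class of a modulo M, membership is constant along the progression outwards. Its partner is
outermost in its own class too, since `R` preserves order and residues, so W' contains a whole
progression. -/
theorem infinite (h : Matching M p W W' R) (hM : 0 < M) (hW : W.Infinite) : W'.Infinite := by
  obtain ⟨B, hB⟩ := h.bounded
  obtain ⟨a, ha, haB⟩ := hW.exists_notMem_finset (Finset.Icc (-B) B)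
  have hr := h.base (a % M) (Int.emod_nonneg _ hM.ne') (Int.emod_lt_of_pos _ hM)
  have hra : M ∣ a % M - a := by
    rw [dvd_sub_comm]
    exact Int.dvd_self_sub_emod
  have hdvd : ∀ {a b}, R a b → M ∣ b - a := fun hab => (Dvd.intro _ rfl).trans (h.dvd hab)
  obtain haB | haB : B < a ∨ a < -B := by
    rw [Finset.mem_Icc] at haB
    omega
  · obtain ⟨a₀, ⟨h₀, b₀, hab⟩, hmax⟩ := Int.exists_greatest_of_bdd
      (P := fun z => M ∣ z - a ∧ ∃ b, R z b)
      ⟨B, fun z hz => by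
        obtain ⟨-, b, hb⟩ := hz
        exact (abs_le.1 (hB _ _ hb).1).2⟩ ⟨_, hra, _, hr⟩
    have hstep : ∀ n : ℕ, a₀ + (n + 1) * M ∈ W ↔ a₀ + (n + 1) * M - M ∈ W := by
      intro n
      refine h.left _ fun b hb => ?_
      have := hmax _ ⟨by
        have := dvd_add h₀ (dvd_mul_left M ((n : ℤ) + 1))
        rwa [show a₀ - a + ((n : ℤ) + 1) * M = a₀ + (n + 1) * M - a by ring] at this, b, hb⟩
      nlinarith
    have ha₀ : a₀ ∈ W := by
      obtain ⟨k, hk⟩ := h₀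
      have : a₀ ≤ a := by
        have := (abs_le.1 (hB _ _ hab).1).2
        omega
      have hk0 : k ≤ 0 := by
        by_contra! hk0
        nlinarith
      obtain ⟨n, hn⟩ := Int.eq_ofNat_of_zero_le (neg_nonneg.2 hk0)
      rw [← mem_add_nsmul_iff hstep n, ← hn]
      convert ha using 1
      linarith
    have hstep' : ∀ n : ℕ, b₀ + (n + 1) * M ∈ W' ↔ b₀ + (n + 1) * M - M ∈ W' := by
      intro n
      refine h.right _ fun z hz => ?_
      have h₁ : a₀ < z := (h.lt_iff hab hz).2 (by nlinarith)
      refine absurd (hmax z ⟨?_, _, hz⟩) (by omega)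
      have := dvd_add (dvd_sub (hdvd hab) (hdvd hz)) (dvd_add h₀ (dvd_mul_left M ((n : ℤ) + 1)))
      rwa [show b₀ - a₀ - (b₀ + (n + 1) * M - z) + (a₀ - a + ((n : ℤ) + 1) * M) = z - a by ring] at this
    refine Set.infinite_of_injective_forall_mem (f := fun n : ℕ => b₀ + n * M) ?_
      fun n => (mem_add_nsmul_iff hstep' n).2 ((h.mem_iff hab).1 ha₀)
    intro m n hmn
    simpa [hM.ne'] using hmn
  -- Downwards the constant progression starts at `a₀ - M`, because membership may jump between `a₀
  -- - M` and `a₀`; this is where `sub_mem_iff` is needed.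
  · obtain ⟨a₀, ⟨h₀, b₀, hab⟩, hmin⟩ := Int.exists_least_of_bdd
      (P := fun z => M ∣ z - a ∧ ∃ b, R z b)
      ⟨-B, fun z hz => by
        obtain ⟨-, b, hb⟩ := hz
        exact (abs_le.1 (hB _ _ hb).1).1⟩ ⟨_, hra, _, hr⟩
    have hstep : ∀ n : ℕ, a₀ - M - n * M ∈ W ↔ a₀ - M - n * M - M ∈ W := by
      intro n
      refine h.left _ fun b hb => ?_
      have := hmin _ ⟨by
        have := dvd_sub h₀ (dvd_mul_left M ((n : ℤ) + 1))
        rwa [show a₀ - a - ((n : ℤ) + 1) * M = a₀ - M - n * M - a by ring] at this, b, hb⟩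
      nlinarith
    have ha₀ : a₀ - M ∈ W := by
      obtain ⟨k, hk⟩ := h₀
      have : a < a₀ := by
        have := (abs_le.1 (hB _ _ hab).1).1
        omega
      have hk0 : 1 ≤ k := by
        by_contra! hk0
        nlinarith
      obtain ⟨n, hn⟩ := Int.eq_ofNat_of_zero_le (sub_nonneg.2 hk0)
      rw [← mem_sub_nsmul_iff hstep n, ← hn]
      convert ha using 1
      linarith
    have hstep' : ∀ n : ℕ, b₀ - M - n * M ∈ W' ↔ b₀ - M - n * M - M ∈ W' := by
      intro n
      refine h.right _ fun z hz => ?_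
      have h₁ : z < a₀ := (h.lt_iff hz hab).2 (by nlinarith)
      refine absurd (hmin z ⟨?_, _, hz⟩) (by omega)
      have := dvd_sub (dvd_add (dvd_sub (hdvd hab) (hdvd hz)) h₀) (dvd_mul_left M ((n : ℤ) + 1))
      rwa [show b₀ - a₀ - (b₀ - M - n * M - z) + (a₀ - a) - ((n : ℤ) + 1) * M = z - a by ring] at this
    refine Set.infinite_of_injective_forall_mem (f := fun n : ℕ => b₀ - M - n * M) ?_
      fun n => (mem_sub_nsmul_iff hstep' n).2 ((h.sub_mem_iff hab).1 ha₀)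
    intro m n hmn
    simpa [hM.ne'] using hmn

end Matching

/-! ### Cardinalities modulo p -/

open Classical in
/-- Summation by parts: the weighted differences of the indicator function of `W` along shifts
by `M` compute the cardinality of `W`. -/
theorem sum_mul_indicator_diff {W : Set ℤ} (hW : W.Finite) {D : Finset ℤ} {M : ℤ}
    (h : ∀ a ∉ D, (a ∈ W ↔ a - M ∈ W)) :
    ∑ a ∈ D, a * ((if a ∈ W then 1 else 0) - (if a - M ∈ W then 1 else 0)) = -M * W.ncard := by
  set V := hW.toFinset with hV
  have hVW : ∀ a, a ∈ W ↔ a ∈ V := fun a => by simp [hV]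
  set V' := V.map (addRightEmbedding M) with hV'
  have hV'W : ∀ a, a - M ∈ W ↔ a ∈ V' := by
    intro a
    rw [hVW, hV', Finset.mem_map]
    simp only [addRightEmbedding_apply, ← eq_sub_iff_add_eq, exists_eq_right]
  -- Terms outside `D` vanish, so the sum may be enlarged to contain `V` and its translate `V'`; it
  -- is then the sum over `V` minus the sum over `V + M`.
  have hsub : ∑ a ∈ D, a * ((if a ∈ W then (1 : ℤ) else 0) - (if a - M ∈ W then 1 else 0)) =
      ∑ a ∈ D ∪ (V ∪ V'), a * ((if a ∈ W then 1 else 0) - (if a - M ∈ W then 1 else 0)) := by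
    refine Finset.sum_subset Finset.subset_union_left fun a _ ha => ?_
    simp [h a ha]
  rw [hsub]
  simp only [mul_sub, mul_ite, mul_one, mul_zero, Finset.sum_sub_distrib, hV'W]
  simp only [hVW]
  rw [Finset.sum_ite_mem, Finset.sum_ite_mem]
  rw [Finset.inter_eq_right.2 (Finset.subset_union_left.trans Finset.subset_union_right),
    Finset.inter_eq_right.2 (Finset.subset_union_right.trans Finset.subset_union_right)]
  rw [hV', Finset.sum_map, Set.ncard_eq_toFinset_card W hW]
  simp [Finset.sum_add_distrib]
  ring

namespace Matching

variable {M p : ℤ} {W W' : Set ℤ} {R : ℤ → ℤ → Prop}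

/-- Matched points carry equal jumps of the indicator functions. The two sums by parts therefore
differ only through the displacements `π a - a`, all divisible by M p, and M cancels. -/
theorem dvd_ncard_sub (h : Matching M p W W' R) (hM : 0 < M) (hW : W.Finite) (hW' : W'.Finite) :
    p ∣ (W'.ncard : ℤ) - W.ncard := by
  classical
  obtain ⟨B, hB⟩ := h.bounded
  set D := (Finset.Icc (-B) B).filter fun a => ∃ b, R a b with hD
  set D' := (Finset.Icc (-B) B).filter fun b => ∃ a, R a b with hD'
  have memD : ∀ a, a ∈ D ↔ ∃ b, R a b := by
    intro a
    simp only [hD, Finset.mem_filter, Finset.mem_Icc, and_iff_right_iff_imp, ← abs_le]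
    rintro ⟨b, hb⟩
    exact (hB a b hb).1
  have memD' : ∀ b, b ∈ D' ↔ ∃ a, R a b := by
    intro b
    simp only [hD', Finset.mem_filter, Finset.mem_Icc, and_iff_right_iff_imp, ← abs_le]
    rintro ⟨a, ha⟩
    exact (hB a b ha).2
  have e₁ := sum_mul_indicator_diff hW (D := D) (M := M)
    fun a ha => h.left a (not_exists.1 (mt (memD a).2 ha))
  have e₂ := sum_mul_indicator_diff hW' (D := D') (M := M)
    fun a ha => h.right a (not_exists.1 (mt (memD' a).2 ha))
  choose! π hπ using fun a (ha : a ∈ D) => (memD a).1 ha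
  have e₃ : ∑ b ∈ D', b * ((if b ∈ W' then (1 : ℤ) else 0) - (if b - M ∈ W' then 1 else 0)) =
      ∑ a ∈ D, π a * ((if a ∈ W then 1 else 0) - (if a - M ∈ W then 1 else 0)) := by
    symm
    refine Finset.sum_bij (fun a _ => π a) (fun a ha => (memD' _).2 ⟨a, hπ a ha⟩)
      (fun a ha a' ha' haa => (h.eq_iff (hπ a ha) (hπ a' ha')).2 haa) (fun b hb => ?_)
      fun a ha => ?_
    · obtain ⟨a, hab⟩ := (memD' b).1 hb
      have ha : a ∈ D := (memD a).2 ⟨b, hab⟩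
      exact ⟨a, ha, (h.eq_iff (hπ a ha) hab).1 rfl⟩
    · simp only [h.mem_iff (hπ a ha), h.sub_mem_iff (hπ a ha)]
  have e₄ : M * p ∣ M * ((W'.ncard : ℤ) - W.ncard) := by
    have : M * ((W'.ncard : ℤ) - W.ncard) =
        -∑ a ∈ D, (π a - a) * ((if a ∈ W then 1 else 0) - (if a - M ∈ W then 1 else 0)) := by
      simp only [sub_mul _ _ (_ - _), Finset.sum_sub_distrib]
      rw [e₁, ← e₃, e₂]
      ring
    rw [this, dvd_neg]
    exact Finset.dvd_sum fun a ha => (h.dvd (hπ a ha)).mul_right _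
  exact Int.dvd_of_mul_dvd_mul_left hM.ne' e₄

end Matching

/-! ### Assignments that small linear forms cannot tell apart -/

/-- The linear form `∑ v ∈ S, c v * x_v + k` evaluated at the assignment `f`. -/
def linForm (S : Finset ℕ) (c : ℕ → ℤ) (k : ℤ) (f : Assignment) : ℤ := ∑ v ∈ S, c v * f v + k

/-- The assignments `f` and `g` agree modulo `M` on `S`, and all linear forms with coefficients
at most `A` and constant at most `C` have the same sign at `f` and at `g`. -/
structure Indist (S : Finset ℕ) (A C M : ℤ) (f g : Assignment) : Prop where
  pos_iff : ∀ c k, (∀ v ∈ S, |c v| ≤ A) → |k| ≤ C → (0 < linForm S c k f ↔ 0 < linForm S c k g)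
  dvd : ∀ v ∈ S, M ∣ f v - g v

/-- `a` solves `α * a = t` at the assignment `f` for a linear form `t` with coefficients at
most `A` and constant at most `K`, where `1 ≤ α ≤ A`. -/
def Critical (S : Finset ℕ) (A K : ℤ) (f : Assignment) (a : ℤ) : Prop :=
  ∃ (α : ℤ) (c : ℕ → ℤ) (k : ℤ), 1 ≤ α ∧ α ≤ A ∧ (∀ v ∈ S, |c v| ≤ A) ∧ |k| ≤ K ∧
    α * a = linForm S c k f

/-- `a` and `b` solve the same equation as in `Critical`, at `f` and at `g`. -/
def CriticalPair (S : Finset ℕ) (A K : ℤ) (f g : Assignment) (a b : ℤ) : Prop :=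
  ∃ (α : ℤ) (c : ℕ → ℤ) (k : ℤ), 1 ≤ α ∧ α ≤ A ∧ (∀ v ∈ S, |c v| ≤ A) ∧ |k| ≤ K ∧
    α * a = linForm S c k f ∧ α * b = linForm S c k g

variable {S : Finset ℕ} {A C K M : ℤ} {f g : Assignment} {x : ℕ} {a b : ℤ}

theorem linForm_combine (m n : ℤ) (c d : ℕ → ℤ) (k l j : ℤ) :
    m * linForm S c k f + n * linForm S d l f + j =
      linForm S (fun v => m * c v + n * d v) (m * k + n * l + j) f := by
  simp only [linForm, mul_add, Finset.mul_sum, add_mul, Finset.sum_add_distrib, mul_assoc]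
  ring

theorem linForm_update (hx : x ∈ S) (c : ℕ → ℤ) (k a : ℤ) :
    linForm S c k (update f x a) = c x * a + linForm S (update c x 0) k f := by
  simp only [linForm]
  rw [← Finset.add_sum_erase _ _ hx, ← Finset.add_sum_erase S (fun v => update c x 0 v * f v) hx]
  have : ∑ v ∈ S.erase x, c v * update f x a v = ∑ v ∈ S.erase x, update c x 0 v * f v := by
    refine Finset.sum_congr rfl fun v hv => ?_
    rw [update_of_ne (Finset.ne_of_mem_erase hv), update_of_ne (Finset.ne_of_mem_erase hv)]
  simp [this, add_assoc]

theorem abs_update_zero_le (hA : 0 ≤ A) {c : ℕ → ℤ} (hc : ∀ v ∈ S, |c v| ≤ A) :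
    ∀ v ∈ S, |update c x 0 v| ≤ A := by
  intro v hv
  obtain rfl | h := eq_or_ne v x
  · simpa using hA
  · simpa [h] using hc v hv

theorem abs_mul_add_mul_le {m n s t U V : ℤ} (hm : |m| ≤ A) (hn : |n| ≤ A) (hs : |s| ≤ U)
    (ht : |t| ≤ V) : |m * s + n * t| ≤ A * (U + V) := by
  have hA : 0 ≤ A := (abs_nonneg m).trans hm
  calc |m * s + n * t| ≤ |m * s| + |n * t| := abs_add_le _ _
    _ ≤ A * U + A * V := by
      rw [abs_mul, abs_mul]
      gcongr
    _ = A * (U + V) := by ring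

namespace Indist

variable {A' C' M' : ℤ}

theorem symm (h : Indist S A C M f g) : Indist S A C M g f where
  pos_iff c k hc hk := (h.pos_iff c k hc hk).symm
  dvd v hv := by
    rw [dvd_sub_comm]
    exact h.dvd v hv

theorem dvd_linForm_sub (h : Indist S A C M f g) (c : ℕ → ℤ) (k : ℤ) :
    M ∣ linForm S c k g - linForm S c k f := by
  have : linForm S c k g - linForm S c k f = ∑ v ∈ S, c v * (g v - f v) := by
    simp only [linForm, mul_sub, Finset.sum_sub_distrib]
    ring
  rw [this]
  refine Finset.dvd_sum fun v hv => Dvd.dvd.mul_left ?_ _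
  rw [dvd_sub_comm]
  exact h.dvd v hv

/-- Comparing solutions of two equations requires cross-multiplication, which raises coefficients
from A to at most 2 A². -/
theorem pos_combine_iff (h : Indist S A' C' M' f g) (hA : 2 * A ^ 2 ≤ A') {m n : ℤ}
    {c d : ℕ → ℤ} {k l j : ℤ} (hm : |m| ≤ A) (hn : |n| ≤ A) (hc : ∀ v ∈ S, |c v| ≤ A)
    (hd : ∀ v ∈ S, |d v| ≤ A) (hj : |m * k + n * l + j| ≤ C') :
    0 < m * linForm S c k f + n * linForm S d l f + j ↔
      0 < m * linForm S c k g + n * linForm S d l g + j := by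
  rw [linForm_combine, linForm_combine]
  refine h.pos_iff _ _ (fun v hv => ?_) hj
  refine (abs_mul_add_mul_le hm hn (hc v hv) (hd v hv)).trans ?_
  linarith

end Indist

/-! ### Critical points and their pairing -/

/-- The form e a + T that changes sign has e ≠ 0, and moves by |e| M ≤ A M, so its value at a is at
most A M in absolute value. Moving that value into the constant gives the equation for a; the sign
of e decides how to make α positive. -/
theorem critical_of_not_indist (hx : x ∈ S) (hA : 0 ≤ A) (hM : 0 < M)
    (h : ¬ Indist S A C M (update f x a) (update f x (a - M))) :
    Critical S A (C + A * M) f a := by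
  have hdvd : ∀ v ∈ S, M ∣ update f x a v - update f x (a - M) v := by
    intro v _
    obtain rfl | hv := eq_or_ne v x
    · simp
    · simp [hv]
  have hsign : ∃ c k, (∀ v ∈ S, |c v| ≤ A) ∧ |k| ≤ C ∧ ¬ (0 < linForm S c k (update f x a) ↔
      0 < linForm S c k (update f x (a - M))) := by
    by_contra! hcon
    exact h ⟨hcon, hdvd⟩
  obtain ⟨c, k, hc, hk, hne⟩ := hsign
  rw [linForm_update hx, linForm_update hx] at hne
  have hcx := hc x hx
  have hc' := abs_update_zero_le (x := x) hA hc
  set e := c x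
  set d := update c x 0
  set T := linForm S d k f with hT
  have hneg : linForm S (fun v => -d v) (-k) f = -T := by
    simp only [hT, linForm, neg_mul, Finset.sum_neg_distrib]
    ring
  have hshift : ∀ (c : ℕ → ℤ) (k j : ℤ), linForm S c (k + j) f = linForm S c k f + j := by
    intro c k j
    simp [linForm, add_assoc]
  rw [abs_le] at hcx hk
  have hmul : e * (a - M) = e * a - e * M := by ring
  rw [hmul] at hne
  obtain he | he | he := lt_trichotomy e 0
  · have h1 : e * M < 0 := mul_neg_of_neg_of_pos he hM
    have h2 : -(A * M) ≤ e * M := by nlinarith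
    refine ⟨-e, d, k + -(e * a + T), by omega, by omega, hc', ?_, ?_⟩
    · rw [abs_le]
      constructor <;> omega
    · rw [hshift]
      linarith
  · simp [he] at hne
  · have h1 : 0 < e * M := mul_pos he hM
    have h2 : e * M ≤ A * M := by nlinarith
    refine ⟨e, fun v => -d v, -k + (e * a + T), by omega, by omega, by simpa using hc', ?_, ?_⟩
    · rw [abs_le]
      constructor <;> omega
    · rw [hshift, hneg]
      linarith

theorem Critical.abs_le (h : Critical S A K f a) : |a| ≤ A * ∑ v ∈ S, |f v| + K := by
  obtain ⟨α, c, k, hα, -, hc, hk, e⟩ := h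
  calc |a| ≤ |α * a| := by
        rw [abs_mul]
        exact le_mul_of_one_le_left (abs_nonneg a) (hα.trans (le_abs_self α))
    _ ≤ ∑ v ∈ S, |c v * f v| + |k| := by
        rw [e]
        exact (abs_add_le _ _).trans (by gcongr; exact Finset.abs_sum_le_sum_abs _ _)
    _ ≤ A * ∑ v ∈ S, |f v| + K := by
        rw [Finset.mul_sum]
        refine add_le_add (Finset.sum_le_sum fun v hv => ?_) hk
        rw [abs_mul]
        exact mul_le_mul_of_nonneg_right (hc v hv) (abs_nonneg _)

/-- The equation 1 * a = a makes small integers critical, so that every residue class contains a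
critical point. -/
theorem critical_of_abs_le (hA : 1 ≤ A) (ha : |a| ≤ K) : Critical S A K f a :=
  ⟨1, 0, a, le_rfl, hA, fun v _ => by simp; omega, ha, by simp [linForm]⟩

namespace CriticalPair

variable {A' C' M' : ℤ}

theorem symm (h : CriticalPair S A K f g a b) : CriticalPair S A K g f b a := by
  obtain ⟨α, c, k, h₁, h₂, h₃, h₄, h₅, h₆⟩ := h
  exact ⟨α, c, k, h₁, h₂, h₃, h₄, h₆, h₅⟩

theorem critical_left (h : CriticalPair S A K f g a b) : Critical S A K f a := by
  obtain ⟨α, c, k, h₁, h₂, h₃, h₄, h₅, -⟩ := h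
  exact ⟨α, c, k, h₁, h₂, h₃, h₄, h₅⟩

/-- Multiplying a < a' by α α' > 0 turns it into positivity of a combination of the two right-hand
sides, free of a and a'. -/
theorem lt_iff (h : Indist S A' C' M' f g) (hA : 2 * A ^ 2 ≤ A') (hC : 2 * A * K ≤ C')
    {a' b' : ℤ} (h₁ : CriticalPair S A K f g a b) (h₂ : CriticalPair S A K f g a' b') :
    a < a' ↔ b < b' := by
  obtain ⟨α, c, k, hα, hαA, hc, hk, ea, eb⟩ := h₁
  obtain ⟨α', c', k', hα', hαA', hc', hk', ea', eb'⟩ := h₂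
  have hm : |α| ≤ A := by rwa [abs_of_pos (by omega)]
  have hm' : |-α'| ≤ A := by rwa [abs_neg, abs_of_pos (by omega)]
  have key := h.pos_combine_iff hA (j := 0) hm hm' hc' hc (k := k') (l := k) (by
    rw [add_zero]
    exact (abs_mul_add_mul_le hm hm' hk' hk).trans (by linarith))
  rw [← ea, ← eb, ← ea', ← eb'] at key
  have hpos : 0 < α * α' := mul_pos (by omega) (by omega)
  have h₃ : ∀ u w : ℤ, 0 < α * (α' * w) + -α' * (α * u) + 0 ↔ u < w := by
    intro u w
    rw [show α * (α' * w) + -α' * (α * u) + 0 = α * α' * (w - u) by ring, mul_pos_iff_of_pos_left hpos,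
      sub_pos]
  rwa [h₃, h₃] at key

theorem dvd_sub (h : Indist S A' C' M' f g) {N : ℤ} (hM : ∀ α, 1 ≤ α → α ≤ A → α * N ∣ M')
    (h₁ : CriticalPair S A K f g a b) : N ∣ b - a := by
  obtain ⟨α, c, k, hα, hαA, -, -, ea, eb⟩ := h₁
  have := (hM α hα hαA).trans (h.dvd_linForm_sub c k)
  rw [← ea, ← eb, ← mul_sub] at this
  exact Int.dvd_of_mul_dvd_mul_left (by omega) this

/-- Multiplying a form in the updated variable by α and substituting α a = t eliminates a, leaving a
form at f that the finer relation controls. The shift s is used with the values 0 and M. -/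
theorem indist_update (hx : x ∈ S) (h : Indist S A' C' M' f g) (hA : 2 * A ^ 2 ≤ A')
    (hC : A * (K + C + A * M) ≤ C') (hMM : ∀ α, 1 ≤ α → α ≤ A → α * M ∣ M') {s : ℤ} (hs : 0 ≤ s)
    (hsM : s ≤ M) (h₁ : CriticalPair S A K f g a b) :
    Indist S A C M (update f x (a - s)) (update g x (b - s)) := by
  have hdvd := h₁.dvd_sub h hMM
  obtain ⟨α, t, l, hα, hαA, ht, hl, ea, eb⟩ := h₁
  refine ⟨fun c k hc hk => ?_, fun v hv => ?_⟩
  · rw [linForm_update hx, linForm_update hx]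
    have hm : |α| ≤ A := by rwa [abs_of_pos (by omega)]
    have hA0 : 0 ≤ A := by omega
    have hj : |-(α * c x * s)| ≤ A * (A * M) := by
      rw [abs_neg, mul_assoc, abs_mul, abs_mul, abs_of_nonneg hs]
      have := hc x hx
      gcongr
    have key := h.pos_combine_iff hA (j := -(α * c x * s)) (hc x hx) hm ht
      (abs_update_zero_le (x := x) hA0 hc) (k := l) (l := k) (by
        refine (abs_add_le _ _).trans ?_
        have := abs_mul_add_mul_le (hc x hx) hm hl hk
        linarith)
    rw [← ea, ← eb] at key
    have h₃ : ∀ u w : ℤ, 0 < c x * (α * u) + α * w + -(α * c x * s) ↔ 0 < c x * (u - s) + w := by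
      intro u w
      rw [show c x * (α * u) + α * w + -(α * c x * s) = α * (c x * (u - s) + w) by ring,
        mul_pos_iff_of_pos_left (by omega)]
    rwa [h₃, h₃] at key
  · obtain rfl | hvx := eq_or_ne v x
    · rw [update_self, update_self, dvd_sub_comm]
      simpa using hdvd
    · rw [update_of_ne hvx, update_of_ne hvx]
      exact (dvd_mul_left M α).trans ((hMM α hα hαA).trans (h.dvd v hv))

end CriticalPair

/-- Solvability at g is divisibility by α, inherited from f because the right-hand side changes by a
multiple of M'. -/
theorem Critical.exists_pair {A' C' M' : ℤ} (h : Indist S A' C' M' f g)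
    (hM : ∀ α, 1 ≤ α → α ≤ A → α ∣ M') (ha : Critical S A K f a) :
    ∃ b, CriticalPair S A K f g a b := by
  obtain ⟨α, c, k, hα, hαA, hc, hk, ea⟩ := ha
  have hd : α ∣ linForm S c k g := by
    have := (hM α hα hαA).trans (h.dvd_linForm_sub c k)
    rw [← ea] at this
    simpa using dvd_add this (dvd_mul_right α a)
  obtain ⟨b, hb⟩ := hd
  exact ⟨b, α, c, k, hα, hαA, hc, hk, ea, hb.symm⟩

/-- The witnesses of an `Indist S A C M`-invariant property are matched along a finer
indistinguishability. -/
theorem Indist.matching {A' C' M' p : ℤ} {Q : Assignment → Prop} (hx : x ∈ S)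
    (hQ : ∀ f g, Indist S A C M f g → (Q f ↔ Q g)) (hA1 : 1 ≤ A) (hC0 : 0 ≤ C) (hM0 : 0 < M)
    (h : Indist S A' C' M' f g) (hA : 2 * A ^ 2 ≤ A') (hC : 2 * A * (C + A * M) ≤ C')
    (hM : ∀ α, 1 ≤ α → α ≤ A → α * (M * p) ∣ M') :
    Matching M p {a | Q (update f x a)} {a | Q (update g x a)}
      (CriticalPair S A (C + A * M) f g) := by
  have hMM : ∀ α, 1 ≤ α → α ≤ A → α * M ∣ M' := fun α h₁ h₂ =>
    (mul_dvd_mul_left α (dvd_mul_right M p)).trans (hM α h₁ h₂)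
  have hαM : ∀ α, 1 ≤ α → α ≤ A → α ∣ M' := fun α h₁ h₂ =>
    (dvd_mul_right α M).trans (hMM α h₁ h₂)
  have hAM : M ≤ A * M := le_mul_of_one_le_left hM0.le hA1
  -- With K = C + A M, `indist_update` and `lt_iff` demand the same bound 2 A (C + A M) on C'.
  have hC' : A * (C + A * M + C + A * M) ≤ C' := by linarith
  refine ⟨fun h₁ h₂ => h₁.lt_iff h hA hC h₂, fun h₁ => h₁.dvd_sub h hM, fun h₁ => ?_, fun h₁ => ?_,
    fun a ha => ?_, fun b hb => ?_, fun r h₀ h₁ => ?_,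
    ⟨max (A * ∑ v ∈ S, |f v| + (C + A * M)) (A * ∑ v ∈ S, |g v| + (C + A * M)), fun a b h₁ =>
      ⟨le_max_of_le_left h₁.critical_left.abs_le, le_max_of_le_right h₁.symm.critical_left.abs_le⟩⟩⟩
  · have := h₁.indist_update hx h hA hC' hMM le_rfl hM0.le
    simp only [sub_zero] at this
    exact hQ _ _ this
  · exact hQ _ _ (h₁.indist_update hx h hA hC' hMM hM0.le le_rfl)
  · refine hQ _ _ (by_contra fun hcon => ?_)
    obtain ⟨b, hb⟩ := (critical_of_not_indist hx (by omega) hM0 hcon).exists_pair h hαM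
    exact ha b hb
  · refine hQ _ _ (by_contra fun hcon => ?_)
    obtain ⟨a, ha⟩ := (critical_of_not_indist hx (by omega) hM0 hcon).exists_pair h.symm hαM
    exact hb a ha.symm
  · exact ⟨1, 0, r, le_rfl, hA1, fun v _ => by simp; omega, by rw [abs_of_nonneg h₀]; omega,
      by simp [linForm], by simp [linForm]⟩

/-! ### The bounds for coefficients, moduli and constants at a given quantifier depth -/

/-- Bound on the coefficients. -/
def coeffBound (P i : ℕ) : ℕ := P ^ 3 ^ i

/-- Bound on the modulus. -/
def modBound (P : ℕ) : ℕ → ℕ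
  | 0 => P.factorial
  | i + 1 => modBound P i * (coeffBound P i).factorial ^ 2

/-- Bound on the constants. -/
def constBound (P C : ℕ) : ℕ → ℕ
  | 0 => C
  | i + 1 => 2 * coeffBound P i * (constBound P C i + coeffBound P i * modBound P i)

section Bounds

variable {P C : ℕ}

theorem coeffBound_succ (P i : ℕ) : coeffBound P (i + 1) = coeffBound P i ^ 3 := by
  rw [coeffBound, coeffBound, pow_succ, pow_mul]

theorem le_coeffBound (P i : ℕ) : P ≤ coeffBound P i :=
  Nat.le_self_pow (by positivity) P

theorem factorial_dvd_modBound (P i : ℕ) : P.factorial ∣ modBound P i := by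
  induction i with
  | zero => exact dvd_rfl
  | succ i ih => exact ih.mul_right _

theorem modBound_pos (P i : ℕ) : 0 < modBound P i := by
  induction i with
  | zero => exact P.factorial_pos
  | succ i ih => exact Nat.mul_pos ih (pow_pos (Nat.factorial_pos _) 2)

theorem le_constBound (hP : 2 ≤ P) (i : ℕ) : C ≤ constBound P C i := by
  induction i with
  | zero => exact le_rfl
  | succ i ih =>
    have := le_coeffBound P i
    rw [constBound]
    nlinarith [Nat.zero_le (coeffBound P i * modBound P i)]

theorem factorial_le_two_pow_sq (A : ℕ) : A.factorial ≤ 2 ^ A ^ 2 :=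
  calc A.factorial ≤ A ^ A := A.factorial_le_pow
    _ ≤ (2 ^ A) ^ A := Nat.pow_le_pow_left A.lt_two_pow_self.le A
    _ = 2 ^ A ^ 2 := by rw [← pow_mul, sq]

/-- Cubing A leaves ample room: the exponent grows to 3 A², which is at most (A³)². -/
theorem modBound_le (hP : 2 ≤ P) (i : ℕ) : modBound P i ≤ 2 ^ coeffBound P i ^ 2 := by
  induction i with
  | zero => simpa [modBound, coeffBound] using factorial_le_two_pow_sq P
  | succ i ih =>
    have hA := hP.trans (le_coeffBound P i)
    rw [modBound, coeffBound_succ]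
    set A := coeffBound P i
    calc modBound P i * A.factorial ^ 2 ≤ 2 ^ A ^ 2 * (2 ^ A ^ 2) ^ 2 :=
          Nat.mul_le_mul ih (Nat.pow_le_pow_left (factorial_le_two_pow_sq A) 2)
      _ = 2 ^ (3 * A ^ 2) := by
        rw [← pow_mul, ← pow_add]
        ring_nf
      _ ≤ 2 ^ (A ^ 3) ^ 2 := by
        refine Nat.pow_le_pow_right two_pos ?_
        calc 3 * A ^ 2 ≤ A ^ 4 * A ^ 2 :=
              Nat.mul_le_mul_right _ ((by norm_num : 3 ≤ 2 ^ 4).trans (Nat.pow_le_pow_left hA 4))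
          _ = (A ^ 3) ^ 2 := by ring

theorem constBound_le (hP : 2 ≤ P) (hC : 1 ≤ C) (i : ℕ) :
    constBound P C i ≤ C * 2 ^ coeffBound P i ^ 2 := by
  induction i with
  | zero => exact Nat.le_mul_of_pos_right _ (by positivity)
  | succ i ih =>
    have hA := hP.trans (le_coeffBound P i)
    have hM := modBound_le hP i
    rw [constBound, coeffBound_succ]
    set A := coeffBound P i
    have h₁ : A ≤ 2 ^ A := A.lt_two_pow_self.le
    have h₂ : 1 + A ≤ 2 ^ A := by
      rw [add_comm]
      exact A.lt_two_pow_self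
    calc 2 * A * (constBound P C i + A * modBound P i)
        ≤ 2 * A * (C * 2 ^ A ^ 2 + A * (C * 2 ^ A ^ 2)) := by
          gcongr
          exact hM.trans (Nat.le_mul_of_pos_left _ hC)
      _ = C * (2 * A * (1 + A) * 2 ^ A ^ 2) := by ring
      _ ≤ C * (2 * 2 ^ A * 2 ^ A * 2 ^ A ^ 2) := by gcongr
      _ = C * 2 ^ (1 + 2 * A + A ^ 2) := by
        rw [pow_add, pow_add]
        ring
      _ ≤ C * 2 ^ (A ^ 3) ^ 2 := by
        refine Nat.mul_le_mul_left C (Nat.pow_le_pow_right two_pos ?_)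
        calc 1 + 2 * A + A ^ 2 ≤ A ^ 4 * A ^ 2 := by
              have : 16 ≤ A ^ 4 := (by norm_num : 16 ≤ 2 ^ 4).trans (Nat.pow_le_pow_left hA 4)
              nlinarith
          _ = (A ^ 3) ^ 2 := by ring

end Bounds

/-! ### Formulas of bounded depth respect indistinguishability -/

namespace Term

theorem coeff_eq_zero {t : Term} {i : ℕ} (h : i ∉ t.vars) : t.coeff i = 0 := by
  induction t with
  | var j => simpa [coeff, vars] using h
  | const c => rfl
  | smul a s ih => simp [coeff, ih h]
  | add s t ihs iht =>
    rw [vars, Finset.notMem_union] at h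
    simp [coeff, ihs h.1, iht h.2]

theorem eval_eq_linForm {S : Finset ℕ} (f : Assignment) {t : Term} (h : t.vars ⊆ S) :
    t.eval f = linForm S (fun v => t.coeff v) t.constTerm f := by
  induction t with
  | var i =>
    have : i ∈ S := h (by simp [vars])
    simp [eval, linForm, coeff, constTerm, this]
  | const c => simp [eval, linForm, coeff, constTerm]
  | smul a s ih =>
    rw [eval, ih h]
    simp [linForm, coeff, constTerm, Finset.mul_sum, mul_add, mul_assoc]
  | add s t ihs iht =>
    rw [vars, Finset.union_subset_iff] at h
    rw [eval, ihs h.1, iht h.2]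
    simp only [linForm, coeff, constTerm, add_mul, Finset.sum_add_distrib]
    ring

theorem eval_congr {f g : Assignment} {t : Term} (h : ∀ v ∈ t.vars, f v = g v) :
    t.eval f = t.eval g := by
  rw [eval_eq_linForm f subset_rfl, eval_eq_linForm g subset_rfl, linForm, linForm]
  congr 1
  exact Finset.sum_congr rfl fun v hv => by rw [h v hv]

end Term

namespace Formula

/-- All variables of a formula, free or quantified. -/
def allVars : Formula → Finset ℕ
  | lt s t => s.vars ∪ t.vars
  | modEq _ _ s t => s.vars ∪ t.vars
  | neg φ => φ.allVars
  | and φ ψ => φ.allVars ∪ ψ.allVars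
  | or φ ψ => φ.allVars ∪ ψ.allVars
  | imp φ ψ => φ.allVars ∪ ψ.allVars
  | iff φ ψ => φ.allVars ∪ ψ.allVars
  | ex x φ => insert x φ.allVars
  | exMod _ _ _ x φ => insert x φ.allVars

theorem holds_congr {φ : Formula} {f g : Assignment} (h : ∀ v ∈ φ.freeVars, f v = g v) :
    φ.Holds f ↔ φ.Holds g := by
  have hupd : ∀ {φ : Formula} {x : ℕ} {f g : Assignment} (a : ℤ),
      (∀ v ∈ φ.freeVars.erase x, f v = g v) →
        ∀ v ∈ φ.freeVars, update f x a v = update g x a v := by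
    intro φ x f g a h v hv
    obtain rfl | hvx := eq_or_ne v x
    · simp
    · simpa [hvx] using h v (Finset.mem_erase.2 ⟨hvx, hv⟩)
  induction φ generalizing f g with
  | lt s t | modEq k hk s t =>
    simp only [freeVars, Finset.mem_union] at h
    rw [Holds, Holds, Term.eval_congr fun v hv => h v (.inl hv),
      Term.eval_congr fun v hv => h v (.inr hv)]
  | neg φ ih => exact not_congr (ih h)
  | and φ ψ ih₁ ih₂ | or φ ψ ih₁ ih₂ | imp φ ψ ih₁ ih₂ | iff φ ψ ih₁ ih₂ =>
    simp only [freeVars, Finset.mem_union] at h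
    simp only [Holds, ih₁ fun v hv => h v (.inl hv), ih₂ fun v hv => h v (.inr hv)]
  | ex x φ ih => exact exists_congr fun a => ih (hupd a h)
  | exMod q p hp x φ ih =>
    have : {a | φ.Holds (update f x a)} = {a | φ.Holds (update g x a)} :=
      Set.ext fun a => ih (hupd a h)
    rw [Holds, Holds, this]

theorem holds_lt_iff {S : Finset ℕ} {A C M : ℤ} {f g : Assignment} (h : Indist S A C M f g)
    {s t : Term} (hs : s.vars ⊆ S) (ht : t.vars ⊆ S) (hA : 0 ≤ A)
    (hcoeff : ∀ a ∈ (lt s t).coeffSet, |a| ≤ A) (hconst : ∀ c ∈ (lt s t).constSet, |c| ≤ C) :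
    (lt s t).Holds f ↔ (lt s t).Holds g := by
  have hst : (t.sub s).vars ⊆ S := Finset.union_subset ht hs
  -- `Indist` tests strict positivity, hence t - s; its normal form is the negative of that of s -
  -- t, which the symmetric parameter sets allow.
  have key : ∀ f : Assignment, (lt s t).Holds f ↔
      0 < linForm S (fun v => (t.sub s).coeff v) (t.sub s).constTerm f := by
    intro f
    rw [← Term.eval_eq_linForm f hst, Holds]
    simp [Term.sub, Term.eval, ← sub_eq_add_neg]
  rw [key, key]
  refine h.pos_iff _ _ (fun v _ => ?_) ?_
  · have e : (t.sub s).coeff v = -(s.sub t).coeff v := by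
      simp only [Term.sub, Term.coeff]
      ring
    rw [e, abs_neg]
    by_cases hv : v ∈ (s.sub t).vars
    · refine hcoeff _ ?_
      simp only [coeffSet, Finset.mem_union, Term.coeffs, Finset.mem_image]
      exact .inl (.inr ⟨v, hv, rfl⟩)
    · rw [Term.coeff_eq_zero hv]
      simpa using hA
  · have e : (t.sub s).constTerm = -(s.sub t).constTerm := by
      simp only [Term.sub, Term.constTerm]
      ring
    rw [e]
    exact hconst _ (by simp [constSet])

theorem holds_modEq_iff {S : Finset ℕ} {A C M : ℤ} {f g : Assignment} (h : Indist S A C M f g)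
    {k : ℕ} {hk : 1 ≤ k} {s t : Term} (hs : s.vars ⊆ S) (ht : t.vars ⊆ S) (hkM : (k : ℤ) ∣ M) :
    (modEq k hk s t).Holds f ↔ (modEq k hk s t).Holds g := by
  have hst : (s.sub t).vars ⊆ S := Finset.union_subset hs ht
  have key : ∀ f : Assignment, (modEq k hk s t).Holds f ↔
      (k : ℤ) ∣ linForm S (fun v => (s.sub t).coeff v) (s.sub t).constTerm f := by
    intro f
    rw [← Term.eval_eq_linForm f hst, Holds]
    simp [Term.sub, Term.eval, ← sub_eq_add_neg]
  rw [key, key]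
  exact (dvd_iff_dvd_of_dvd_sub (hkM.trans (h.dvd_linForm_sub _ _))).symm

/-- Formulas of quantifier depth at most `i` cannot distinguish assignments that are
indistinguishable for the bounds at depth `i`. -/
theorem holds_iff_of_indist {P C : ℕ} (hP : 2 ≤ P) {S : Finset ℕ} {φ : Formula}
    (hS : φ.allVars ⊆ S) (hcoeff : ∀ a ∈ φ.coeffSet, |a| ≤ (P : ℤ))
    (hconst : ∀ c ∈ φ.constSet, |c| ≤ (C : ℤ)) (hmod : ∀ k ∈ φ.modSet, k ≤ P)
    {i : ℕ} (hi : φ.qd ≤ i) {f g : Assignment}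
    (h : Indist S (coeffBound P i) (constBound P C i) (modBound P i) f g) :
    φ.Holds f ↔ φ.Holds g := by
  have step : ∀ {φ : Formula} {i p x : ℕ} {f g : Assignment}, x ∈ S → 1 ≤ p → p ≤ P →
      (∀ f g, Indist S (coeffBound P i) (constBound P C i) (modBound P i) f g →
        (φ.Holds f ↔ φ.Holds g)) →
      Indist S (coeffBound P (i + 1)) (constBound P C (i + 1)) (modBound P (i + 1)) f g →
      Matching (modBound P i) p {a | φ.Holds (update f x a)} {a | φ.Holds (update g x a)}
        (CriticalPair S (coeffBound P i)
          (constBound P C i + coeffBound P i * modBound P i) f g) := by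
    intro φ i p x f g hx hp hpP hφ h
    have hPA := le_coeffBound P i
    refine Indist.matching hx hφ (by omega) (by positivity) (by exact_mod_cast modBound_pos P i) h
      ?_ ?_ ?_
    -- 2 A² ≤ A³ because A ≥ 2: the reason for cubing at each level.
    · rw [coeffBound_succ]
      norm_cast
      rw [pow_succ' _ 2]
      exact Nat.mul_le_mul_right _ (hP.trans hPA)
    · rw [constBound]
      push_cast
      exact le_rfl
    · intro α hα hαA
      lift α to ℕ using by omega
      rw [modBound]
      norm_cast at hα hαA ⊢
      -- One factorial absorbs α, the other absorbs p.
      rw [Nat.mul_left_comm, sq]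
      exact Nat.mul_dvd_mul_left _ (Nat.mul_dvd_mul (Nat.dvd_factorial hα hαA)
        (Nat.dvd_factorial hp (hpP.trans hPA)))
  induction φ generalizing i f g with
  | lt s t =>
    rw [allVars, Finset.union_subset_iff] at hS
    exact holds_lt_iff h hS.1 hS.2 (by positivity)
      (fun a ha => (hcoeff a ha).trans (by exact_mod_cast le_coeffBound P i))
      fun c hc => (hconst c hc).trans (by exact_mod_cast le_constBound hP i)
  | modEq k hk s t =>
    rw [allVars, Finset.union_subset_iff] at hS
    refine holds_modEq_iff h hS.1 hS.2 (Int.natCast_dvd_natCast.2 ?_)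
    exact (Nat.dvd_factorial hk (hmod k (by simp [modSet]))).trans (factorial_dvd_modBound P i)
  | neg φ ih => exact not_congr (ih hS hcoeff hconst hmod hi h)
  | and φ ψ ih₁ ih₂ | or φ ψ ih₁ ih₂ | imp φ ψ ih₁ ih₂ | iff φ ψ ih₁ ih₂ =>
    rw [allVars, Finset.union_subset_iff] at hS
    simp only [coeffSet, constSet, modSet, Finset.mem_union] at hcoeff hconst hmod
    rw [qd, max_le_iff] at hi
    have e₁ := ih₁ hS.1 (fun a ha => hcoeff a (.inl ha)) (fun a ha => hconst a (.inl ha))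
      (fun a ha => hmod a (.inl ha)) hi.1 h
    have e₂ := ih₂ hS.2 (fun a ha => hcoeff a (.inr ha)) (fun a ha => hconst a (.inr ha))
      (fun a ha => hmod a (.inr ha)) hi.2 h
    simp only [Holds, e₁, e₂]
  | ex x φ ih =>
    obtain ⟨i, rfl⟩ := Nat.exists_eq_add_of_le' ((Nat.le_add_right 1 _).trans hi)
    rw [allVars, Finset.insert_subset_iff] at hS
    rw [qd, add_comm, Nat.add_le_add_iff_right] at hi
    -- For a plain ∃ no counting is needed, so p = 1.
    have m := step hS.1 le_rfl (by omega) (fun f g => ih hS.2 hcoeff hconst hmod hi) h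
    have hM : (0 : ℤ) < modBound P i := by exact_mod_cast modBound_pos P i
    exact ⟨m.nonempty hM, m.symm.nonempty hM⟩
  | exMod q p hp x φ ih =>
    obtain ⟨i, rfl⟩ := Nat.exists_eq_add_of_le' ((Nat.le_add_right 1 _).trans hi)
    rw [allVars, Finset.insert_subset_iff] at hS
    rw [qd, add_comm, Nat.add_le_add_iff_right] at hi
    simp only [modSet, Finset.mem_insert, forall_eq_or_imp] at hmod
    have m := step hS.1 (by omega) hmod.1 (fun f g => ih hS.2 hcoeff hconst hmod.2 hi) h
    have hM : (0 : ℤ) < modBound P i := by exact_mod_cast modBound_pos P i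
    have hfin : {a | φ.Holds (update f x a)}.Finite ↔ {a | φ.Holds (update g x a)}.Finite :=
      ⟨fun hf => by_contra fun hg => m.symm.infinite hM hg hf,
        fun hg => by_contra fun hf => m.infinite hM hf hg⟩
    rw [Holds, Holds, hfin]
    refine and_congr_right fun hg => ?_
    have hcard := Nat.modEq_iff_dvd.2 (m.dvd_ncard_sub hM (hfin.2 hg) hg)
    exact ⟨hcard.symm.trans, hcard.trans⟩

/-! ### Maxima of the parameters and the witness bound -/

/-- Coeff(φ) is closed under negation, so its maximum bounds absolute values. -/
theorem abs_le_maxPar {φ : Formula} : ∀ a ∈ φ.coeffSet, |a| ≤ (φ.maxPar : ℤ) := by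
  have hneg : ∀ {φ : Formula} {a}, a ∈ φ.coeffSet → -a ∈ φ.coeffSet := by
    intro φ a ha
    induction φ with
    | lt s t =>
      simp only [coeffSet, Finset.mem_union, Finset.mem_insert, Finset.mem_singleton,
        Finset.mem_image] at ha ⊢
      obtain (ha | ha) | ⟨b, hb, rfl⟩ := ha
      · left; left; omega
      · exact .inr ⟨a, ha, rfl⟩
      · left; right; simpa using hb
    | modEq k hk s t =>
      simp only [coeffSet, Finset.mem_insert, Finset.mem_singleton] at ha ⊢
      omega
    | neg φ ih | ex x φ ih | exMod q p hp x φ ih => exact ih ha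
    | and φ ψ ih₁ ih₂ | or φ ψ ih₁ ih₂ | imp φ ψ ih₁ ih₂ | iff φ ψ ih₁ ih₂ =>
      simp only [coeffSet, Finset.mem_union] at ha ⊢
      exact ha.imp ih₁ ih₂
  intro a ha
  rw [coe_maxPar]
  exact abs_le'.2 ⟨Finset.le_max' _ _ (Finset.mem_union_left _ ha),
    Finset.le_max' _ _ (Finset.mem_union_left _ (hneg ha))⟩

theorem abs_le_maxConst {φ : Formula} : ∀ c ∈ φ.constSet, |c| ≤ (φ.maxConst : ℤ) := by
  have hneg : ∀ {φ : Formula} {a}, a ∈ φ.constSet → -a ∈ φ.constSet := by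
    intro φ a ha
    induction φ with
    | lt s t =>
      simp only [constSet, Finset.mem_insert, Finset.mem_singleton] at ha ⊢
      omega
    | modEq k hk s t =>
      simp only [constSet, Finset.mem_insert, Finset.mem_singleton] at ha ⊢
      omega
    | neg φ ih | ex x φ ih | exMod q p hp x φ ih => exact ih ha
    | and φ ψ ih₁ ih₂ | or φ ψ ih₁ ih₂ | imp φ ψ ih₁ ih₂ | iff φ ψ ih₁ ih₂ =>
      simp only [constSet, Finset.mem_union] at ha ⊢
      exact ha.imp ih₁ ih₂
  intro a ha
  rw [coe_maxConst]
  exact abs_le'.2 ⟨Finset.le_max' _ _ ha, Finset.le_max' _ _ (hneg ha)⟩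

theorem le_maxPar_of_mem_modSet {φ : Formula} : ∀ k ∈ φ.modSet, k ≤ φ.maxPar := by
  intro k hk
  rw [← Nat.cast_le (α := ℤ), coe_maxPar]
  exact Finset.le_max' _ _ (Finset.mem_union_right _ (Finset.mem_image_of_mem _ hk))

theorem two_le_maxPar (φ : Formula) : 2 ≤ φ.maxPar := by
  have := φ.abs_le_maxPar 2 φ.two_mem_coeffSet
  simpa using this

theorem two_le_maxConst (φ : Formula) : 2 ≤ φ.maxConst := by
  have := φ.abs_le_maxConst 2 φ.two_mem_constSet
  simpa using this

/-- A satisfiable formula has a witness bounded in terms of the absolute values of the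
parameters. -/
theorem exists_witness_le {φ : Formula} {x d : ℕ} {f : Assignment} (hd : φ.qd ≤ d)
    (hφ : ∃ a, φ.Holds (update f x a)) {L : ℤ}
    (hL : ∑ v ∈ insert x φ.allVars, |f v| ≤ L) :
    ∃ m : ℤ, |m| ≤ coeffBound φ.maxPar d * L + (constBound φ.maxPar φ.maxConst d +
      coeffBound φ.maxPar d * modBound φ.maxPar d) + modBound φ.maxPar d ∧
        φ.Holds (update f x m) := by
  have hP := φ.two_le_maxPar
  set P := φ.maxPar
  set C := φ.maxConst
  set S := insert x φ.allVars
  have hx : x ∈ S := Finset.mem_insert_self _ _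
  have hA : (1 : ℤ) ≤ coeffBound P d := by
    have := le_coeffBound P d
    omega
  have hM : (0 : ℤ) < modBound P d := by exact_mod_cast modBound_pos P d
  have hAM := le_mul_of_one_le_left hM.le hA
  obtain ⟨a, ha, haW⟩ : ∃ a ∈ {a | Critical S (coeffBound P d)
      (constBound P C d + coeffBound P d * modBound P d) f a},
      a ∈ {a | φ.Holds (update f x a)} ∨ a - modBound P d ∈ {a | φ.Holds (update f x a)} := by
    -- Off critical points, f updated at a and at a - M is indistinguishable at level d, so φ cannot
    -- separate the two.
    refine exists_critical hM (fun a ha => ?_) (fun r h₀ h₁ => critical_of_abs_le hA ?_) hφ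
    · exact holds_iff_of_indist hP (Finset.subset_insert _ _) φ.abs_le_maxPar φ.abs_le_maxConst
        φ.le_maxPar_of_mem_modSet hd
        (by_contra fun hcon => ha (critical_of_not_indist hx (zero_le_one.trans hA) hM hcon))
    · rw [abs_of_nonneg h₀]
      have : (0 : ℤ) ≤ constBound P C d := by positivity
      omega
  have hbound := Critical.abs_le ha
  have := mul_le_mul_of_nonneg_left hL (zero_le_one.trans hA)
  obtain h | h := haW
  · exact ⟨a, by linarith, h⟩
  · refine ⟨a - modBound P d, ?_, h⟩
    have := abs_sub a (modBound P d : ℤ)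
    rw [abs_of_pos hM] at this
    linarith

theorem witnessBound_le {P C N l d : ℕ} (hP : 2 ≤ P) (hC : 1 ≤ C) (hN : 1 ≤ N) (hd : 1 ≤ d) :
    coeffBound P d * (l * N) + (constBound P C d + coeffBound P d * modBound P d) + modBound P d ≤
      2 ^ P ^ 9 ^ d * C * N * max 1 l := by
  have hA := hP.trans (le_coeffBound P d)
  have hMle := modBound_le hP d
  have hCle := constBound_le hP hC d
  -- The final exponent 1 + A + A² is at most A³ = P^(3^(d+1)), and d + 1 ≤ 2 d for d ≥ 1; this is
  -- the origin of κ = 9.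
  have hpow : coeffBound P d ^ 3 ≤ P ^ 9 ^ d := by
    rw [coeffBound, ← pow_mul, ← pow_succ, show 9 = 3 ^ 2 by norm_num, ← pow_mul]
    exact Nat.pow_le_pow_right (by omega) (Nat.pow_le_pow_right (by omega) (by omega))
  set A := coeffBound P d
  set Q := C * N * max 1 l with hQ
  have hQC : C ≤ Q := by
    rw [hQ, mul_assoc]
    exact Nat.le_mul_of_pos_right _ (by positivity)
  have hQl : l * N ≤ Q := by
    rw [hQ, mul_assoc, mul_comm l]
    exact (Nat.mul_le_mul_left N (le_max_right 1 l)).trans (Nat.le_mul_of_pos_left _ hC)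
  have hQ1 : 1 ≤ Q := hC.trans hQC
  have h₁ : 1 + A ≤ 2 ^ A := by
    rw [add_comm]
    exact A.lt_two_pow_self
  have hM' : modBound P d ≤ Q * 2 ^ A ^ 2 := hMle.trans (Nat.le_mul_of_pos_left _ hQ1)
  have hlN : l * N ≤ Q * 2 ^ A ^ 2 := hQl.trans (Nat.le_mul_of_pos_right _ (by positivity))
  have hC' : constBound P C d ≤ Q * 2 ^ A ^ 2 := hCle.trans (Nat.mul_le_mul_right _ hQC)
  calc A * (l * N) + (constBound P C d + A * modBound P d) + modBound P d
      ≤ A * (Q * 2 ^ A ^ 2) + (Q * 2 ^ A ^ 2 + A * (Q * 2 ^ A ^ 2)) + Q * 2 ^ A ^ 2 := by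
        have := Nat.mul_le_mul_left A hlN
        have := Nat.mul_le_mul_left A hM'
        omega
    _ = 2 * (1 + A) * 2 ^ A ^ 2 * Q := by ring
    _ ≤ 2 * 2 ^ A * 2 ^ A ^ 2 * Q := by gcongr
    _ = 2 ^ (1 + A + A ^ 2) * Q := by
      rw [pow_add, pow_add]
      ring
    _ ≤ 2 ^ P ^ 9 ^ d * Q := by
      refine Nat.mul_le_mul_right _ (Nat.pow_le_pow_right two_pos (le_trans ?_ hpow))
      nlinarith [Nat.mul_le_mul_right (A ^ 2) hA]
    _ = 2 ^ P ^ 9 ^ d * C * N * max 1 l := by rw [hQ]; ring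

end Formula

end PresburgerMod

/-- The formula `φ = φ(x, y_1, …, y_ℓ)` has its free variables among the distinct variables
`x, y_1, …, y_ℓ`, and `f` is any assignment that maps `y_i` to `n_i`. -/
theorem corollaryC1 :
    ∃ κ : ℕ, 2 ≤ κ ∧
      ∀ (d : ℕ) (_ : 1 ≤ d) (ℓ : ℕ) (φ : PresburgerMod.Formula) (x : ℕ) (y : Fin ℓ → ℕ)
        (_ : Function.Injective y) (_ : ∀ i, y i ≠ x)
        (_ : ∀ v ∈ φ.freeVars, v = x ∨ ∃ i, v = y i)
        (_ : φ.qd ≤ d)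
        (N : ℕ) (_ : 1 ≤ N) (n : Fin ℓ → ℤ) (_ : ∀ i, |n i| ≤ (N : ℤ))
        (f : PresburgerMod.Assignment) (_ : ∀ i, f (y i) = n i),
        (PresburgerMod.Formula.ex x φ).Holds f ↔
          ∃ m : ℤ,
            |m| ≤ ((2 ^ (φ.maxPar ^ (κ ^ d)) * φ.maxConst * N * max 1 ℓ : ℕ) : ℤ) ∧
              φ.Holds (Function.update f x m) := by
  refine ⟨9, by norm_num, fun d hd ℓ φ x y _ _ hfree hqd N hN n hn f hf => ?_⟩
  refine ⟨fun h => ?_, fun ⟨m, _, hm⟩ => ⟨m, hm⟩⟩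
  classical
  set Y := Finset.univ.image y with hY
  -- The bound sums over all variables, bound ones included. Zeroing f outside the y_i leaves the
  -- truth of φ unchanged and makes the sum at most ℓ N.
  set g : PresburgerMod.Assignment := fun v => if v ∈ Y then f v else 0 with hg
  have hfg : ∀ a, φ.Holds (Function.update f x a) ↔ φ.Holds (Function.update g x a) := by
    refine fun a => PresburgerMod.Formula.holds_congr fun v hv => ?_
    obtain rfl | hvx := eq_or_ne v x
    · simp
    · obtain rfl | ⟨i, rfl⟩ := hfree v hv
      · exact absurd rfl hvx
      · simp [hvx, hg, hY]
  have hsum : ∀ S : Finset ℕ, ∑ v ∈ S, |g v| ≤ (ℓ : ℤ) * N := by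
    intro S
    calc ∑ v ∈ S, |g v| = ∑ v ∈ S ∩ Y, |f v| := by
          simp only [hg, apply_ite abs, abs_zero, Finset.sum_ite_mem]
      _ ≤ (S ∩ Y).card • (N : ℤ) := by
          refine Finset.sum_le_card_nsmul _ _ _ fun v hv => ?_
          obtain ⟨i, -, rfl⟩ := Finset.mem_image.1 (Finset.mem_inter.1 hv).2
          rw [hf]
          exact hn i
      _ ≤ (ℓ : ℤ) * N := by
          rw [nsmul_eq_mul]
          gcongr
          exact (Finset.card_le_card Finset.inter_subset_right).trans
            (Finset.card_image_le.trans (by simp))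
  obtain ⟨m, hm, hφ⟩ := PresburgerMod.Formula.exists_witness_le hqd
    (h.imp fun a => (hfg a).1) (hsum _)
  refine ⟨m, hm.trans ?_, (hfg m).2 hφ⟩
  exact_mod_cast PresburgerMod.Formula.witnessBound_le φ.two_le_maxPar
    (one_le_two.trans φ.two_le_maxConst) hN hd
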